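/- Consider a finite network with a finite set $J$ of resources with capacities $C_j>0$ and a finite set $I$ of flow types, where a flow of type $i\in I$ can use each single resource in a non-empty set $J(i)\subseteq J$ (so all routes have length one). Let $n_i\ge 0$ be the number of flows of type $i$, and let $U$ be a strictly concave, strictly increasing and differentiable utility function, common to all types, real-valued on $(0,\infty)$ and with $U(0)\in[-\infty,\infty)$. Let $(x_i)_{i\in I}$ be the rate allocation, i.e. the vector that maximizes $\sum_{i\in I} n_i U(x_i)$ over all $x$ for which there are $x_i^j\ge 0$ ($i\in I$, $j\in J(i)$) with $$\sum_{j\in J(i)}x_i^j=x_i\quad(i\in I),\qquad \sum_{i:\,j\in J(i)}n_i x_i^j\le C_j\quad(j\in J),$$ where $0\cdot(-\infty)=0$ and, by convention, $x_i=0$ if $n_i=0$. For $J'\subseteq J$ write $I(J')=\{i\in I: J(i)\subseteq J'\}$ and $C(J')=\sum_{j\in J'}C_j$. Then for each $i\in I$ with $n_i>0$, $$x_i\ \ge\ \min_{J'\subseteq J:\ i\in I(J')}\ \frac{C(J')}{\sum_{i'\in I(J')}n_{i'}}.$$ -/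

import Mathlib

/-- A finite network in which every route consists of a single resource: resources `j : J` have
capacities `cap j`, and flow type `i : I` can use the resources in the set `res i` (the set `J(i)`).
Capacities are positive and every flow type can use at least one resource. -/
structure Network (I J : Type*) where
  cap : J → ℝ
  res : I → Finset J
  cap_pos : ∀ j, 0 < cap j
  res_nonempty : ∀ i, (res i).Nonempty

/-- A utility function on `[0, ∞)`: strictly increasing, strictly concave and differentiable.
It is real-valued on `(0, ∞)` (this follows from strict monotonicity on `[0, ∞)`), but `U 0 = -∞`
is allowed, as for `U x = log x` and `U x = x ^ (1 - α) / (1 - α)` with `α > 1`. -/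
structure IsUtility (U : ℝ → EReal) : Prop where
  strictMonoOn : StrictMonoOn U (Set.Ici 0)
  strictConcaveOn : StrictConcaveOn ℝ (Set.Ioi 0) (fun x => (U x).toReal)
  differentiableOn : DifferentiableOn ℝ (fun x => (U x).toReal) (Set.Ioi 0)

namespace Network

variable {I J : Type*} [Fintype I] [DecidableEq J]

/-- The rates `x i` are feasible, when there are `n i` flows of type `i`: each `x i` can be split
as a sum of nonnegative rates `y i j` received from the resources `j ∈ J(i)`, such that no
capacity is exceeded. -/
def Feasible (N : Network I J) (n : I → ℝ) (x : I → ℝ) : Prop :=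
  ∃ y : I → J → ℝ,
    (∀ j, ∑ i with j ∈ N.res i, n i * y i j ≤ N.cap j) ∧
    (∀ i, ∑ j ∈ N.res i, y i j = x i) ∧
    (∀ i, ∀ j ∈ N.res i, 0 ≤ y i j)

/-- `x` is the vector of rates allocated to the flows: it maximizes `∑ i, n i * U (x i)` over the
feasible rate vectors, with the convention that `x i = 0` if `n i = 0`.
(In `EReal`, `0 * (-∞) = 0`, so types with `n i = 0` do not contribute.) -/
def IsRateAllocation (N : Network I J) (U : ℝ → EReal) (n : I → ℝ) (x : I → ℝ) : Prop :=
  N.Feasible n x ∧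
  IsMaxOn (fun z : I → ℝ => ∑ i, (n i : EReal) * U (z i)) {z | N.Feasible n z} x ∧
  ∀ i, n i = 0 → x i = 0

/-- `I(J')`: the flow types that can only use resources in `J'`. -/
def flowsIn (N : Network I J) (J' : Finset J) : Finset I :=
  {i | N.res i ⊆ J'}

/-- `C(J')`: the total capacity of the resources in `J'`. -/
def capOf (N : Network I J) (J' : Finset J) : ℝ :=
  ∑ j ∈ J', N.cap j

/-- The sets `J'` of resources with `i ∈ I(J')`. -/
def setsContaining [Fintype J] [DecidableEq I] (N : Network I J) (i : I) : Finset (Finset J) :=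
  {J' | i ∈ N.flowsIn J'}

theorem setsContaining_nonempty [Fintype J] [DecidableEq I] (N : Network I J) (i : I) :
    (N.setsContaining i).Nonempty :=
  ⟨Finset.univ, by simp [setsContaining, flowsIn]⟩

end Network

/-! Fix `i`, let `F` be the types present with rate at most `x i`, and let `J'` be all resources
they can use. Every resource in `J'` is saturated (`load_eq_cap`) and serves only `F`: a type
drawing rate from a resource open to some `l ∈ F` has rate at most `x l ≤ x i`
(`le_of_shared_resource`). Hence `C(J') = ∑ k ∈ F, n k * x k ≤ x i * ∑ k ∈ F, n k`, and `F ⊆ I(J')`,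
so the ratio at `J'` is already at most `x i`. Both lemmas perturb the optimum at a single resource;
the second rests on strict concavity. -/

namespace IsUtility

variable {U : ℝ → EReal}

theorem ne_top (hU : IsUtility U) {t : ℝ} (ht : 0 ≤ t) : U t ≠ ⊤ :=
  (lt_of_lt_of_le (hU.strictMonoOn (Set.mem_Ici.2 ht)
    (Set.mem_Ici.2 (by linarith : (0 : ℝ) ≤ t + 1)) (by linarith)) le_top).ne

theorem ne_bot (hU : IsUtility U) {t : ℝ} (ht : 0 < t) : U t ≠ ⊥ :=
  (lt_of_le_of_lt bot_le (hU.strictMonoOn (Set.mem_Ici.2 le_rfl)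
    (Set.mem_Ici.2 ht.le) ht)).ne'

theorem toReal_lt_toReal (hU : IsUtility U) {s t : ℝ} (hs : 0 ≤ s) (hst : s < t)
    (hbot : U s ≠ ⊥) : (U s).toReal < (U t).toReal := by
  rw [← EReal.coe_lt_coe_iff, EReal.coe_toReal (hU.ne_top hs) hbot,
    EReal.coe_toReal (hU.ne_top (hs.trans hst.le)) (hU.ne_bot (hs.trans_lt hst))]
  exact hU.strictMonoOn (Set.mem_Ici.2 hs) (Set.mem_Ici.2 (hs.trans hst.le)) hst

theorem slope_anti_of_pos (hU : IsUtility U) {a b c d : ℝ} (ha : 0 < a) (hab : a < b)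
    (hbc : b ≤ c) (hcd : c < d) :
    ((U d).toReal - (U c).toReal) / (d - c) < ((U b).toReal - (U a).toReal) / (b - a) := by
  have h := hU.strictConcaveOn
  have ha' : a ∈ Set.Ioi (0 : ℝ) := ha
  have hb' : b ∈ Set.Ioi (0 : ℝ) := ha.trans hab
  have hd' : d ∈ Set.Ioi (0 : ℝ) := ha.trans (hab.trans_le (hbc.trans hcd.le))
  rcases hbc.eq_or_lt with rfl | hbc
  · exact h.slope_anti_adjacent ha' hd' hab hcd
  · exact (h.slope_anti_adjacent hb' hd' hbc hcd).trans
      (h.slope_anti_adjacent ha' (ha.trans (hab.trans hbc)) hab hbc)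

/-- The utility gained per unit of rate decreases strictly, also on intervals starting at `0`
(if `U 0` is finite), although `U` need not be continuous there. -/
theorem slope_anti (hU : IsUtility U) {a b c d : ℝ} (ha : 0 ≤ a) (hbot : U a ≠ ⊥) (hab : a < b)
    (hbc : b ≤ c) (hcd : c < d) :
    ((U d).toReal - (U c).toReal) / (d - c) < ((U b).toReal - (U a).toReal) / (b - a) := by
  rcases ha.eq_or_lt with rfl | ha
  · have hb2 : 0 < b / 2 := by linarith
    have hmid := hU.slope_anti_of_pos hb2 (by linarith : b / 2 < b) hbc hcd
    set s := ((U b).toReal - (U (b / 2)).toReal) / (b - b / 2) with hs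
    refine hmid.trans_le ?_
    rw [sub_zero, le_div_iff₀ hab]
    -- For `0 < t < b / 2`, concavity gives `s * (b - t) < U b - U t`, and monotonicity gives `U 0 <
    -- U t`; let `t → 0`. Strictness is not lost in the limit, since `hmid` is strict.
    have hlim : Filter.Tendsto (fun t : ℝ => s * (b - t)) (nhdsWithin 0 (Set.Ioi 0))
        (nhds (s * b)) := by
      have : Continuous fun t : ℝ => s * (b - t) := by fun_prop
      simpa using (this.tendsto 0).mono_left nhdsWithin_le_nhds
    refine le_of_tendsto hlim ?_
    filter_upwards [Ioo_mem_nhdsGT hb2] with t ht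
    have h1 := hU.slope_anti_of_pos ht.1 ht.2 le_rfl (by linarith : b / 2 < b)
    have h2 := hU.toReal_lt_toReal le_rfl ht.1 hbot
    rw [← hs, lt_div_iff₀ (by linarith [ht.2])] at h1
    have h3 : s * (b - b / 2) = (U b).toReal - (U (b / 2)).toReal :=
      div_mul_cancel₀ _ (by linarith)
    linarith
  · exact hU.slope_anti_of_pos ha hab hbc hcd

end IsUtility

theorem EReal.coe_finset_sum {ι : Type*} (s : Finset ι) (f : ι → ℝ) :
    ((∑ i ∈ s, f i : ℝ) : EReal) = ∑ i ∈ s, (f i : EReal) :=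
  map_sum (⟨⟨Real.toEReal, EReal.coe_zero⟩, EReal.coe_add⟩ : ℝ →+ EReal) f s

theorem EReal.sum_eq_bot_of_mem {ι : Type*} {s : Finset ι} {f : ι → EReal} {i : ι}
    (hi : i ∈ s) (h : f i = ⊥) : ∑ k ∈ s, f k = ⊥ := by
  classical
  rw [← Finset.add_sum_erase s f hi, h, EReal.bot_add]

namespace Network

variable {I J : Type*} [Fintype I] [DecidableEq J]

theorem Feasible.nonneg {N : Network I J} {n x : I → ℝ} (hx : N.Feasible n x) (i : I) :
    0 ≤ x i := by
  obtain ⟨y, -, hy, hy0⟩ := hx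
  rw [← hy i]
  exact Finset.sum_nonneg (hy0 i)

theorem exists_feasible_pos [Finite J] (N : Network I J) (n : I → ℝ) (hn : ∀ i, 0 ≤ n i) :
    ∃ z, N.Feasible n z ∧ ∀ i, 0 < z i := by
  obtain ⟨t, ht, htcap⟩ : ∃ t : ℝ, 0 < t ∧ ∀ j, (∑ i, n i) * t ≤ N.cap j := by
    have h : ∀ j, ∀ᶠ t in nhdsWithin (0 : ℝ) (Set.Ioi 0), (∑ i, n i) * t ≤ N.cap j := by
      intro j
      have hc : Filter.Tendsto (fun t : ℝ => (∑ i, n i) * t) (nhdsWithin 0 (Set.Ioi 0))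
          (nhds 0) := by
        have : Continuous fun t : ℝ => (∑ i, n i) * t := by fun_prop
        simpa using (this.tendsto 0).mono_left nhdsWithin_le_nhds
      exact hc.eventually_le_const (N.cap_pos j)
    obtain ⟨t, h1, h2⟩ := ((Filter.eventually_all.2 h).and self_mem_nhdsWithin).exists
    exact ⟨t, h2, h1⟩
  refine ⟨fun i => ∑ _j ∈ N.res i, t, ⟨fun _ _ => t, fun j => ?_, fun _ => rfl,
    fun _ _ _ => ht.le⟩, fun i => Finset.sum_pos (fun _ _ => ht) (N.res_nonempty i)⟩
  rw [← Finset.sum_mul]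
  exact (mul_le_mul_of_nonneg_right
    (Finset.sum_le_univ_sum_of_nonneg hn) ht.le).trans (htcap j)

theorem sum_mul_utility_eq_coe {U : ℝ → EReal} (hU : IsUtility U) {n z : I → ℝ}
    (hz : ∀ i, 0 ≤ z i) (hbot : ∀ i, n i ≠ 0 → U (z i) ≠ ⊥) :
    ∑ i, (n i : EReal) * U (z i) = ((∑ i, n i * (U (z i)).toReal : ℝ) : EReal) := by
  rw [EReal.coe_finset_sum]
  refine Finset.sum_congr rfl fun i _ => ?_
  by_cases h : n i = 0
  · simp [h]
  · rw [EReal.coe_mul, EReal.coe_toReal (hU.ne_top (hz i)) (hbot i h)]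

/-- One `⊥` term of positive weight would make the optimal total `⊥`, whereas a strictly positive
feasible vector has a finite total. From here on utilities can be compared in `ℝ`. -/
theorem IsRateAllocation.utility_ne_bot [Finite J] {N : Network I J} {U : ℝ → EReal}
    (hU : IsUtility U) {n x : I → ℝ} (hn : ∀ i, 0 ≤ n i) (hx : N.IsRateAllocation U n x)
    {i : I} (hi : n i ≠ 0) : U (x i) ≠ ⊥ := by
  intro h
  obtain ⟨z, hz, hzpos⟩ := N.exists_feasible_pos n hn
  have hle := hx.2.1 hz
  simp only [Set.mem_ofPred_eq] at hle
  rw [sum_mul_utility_eq_coe hU hz.nonneg fun i _ => hU.ne_bot (hzpos i),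
    EReal.sum_eq_bot_of_mem (Finset.mem_univ i)
      (by rw [h, EReal.coe_mul_bot_of_pos ((hn i).lt_of_ne' hi)])] at hle
  exact EReal.coe_ne_bot _ (le_bot_iff.1 hle)

theorem IsRateAllocation.sum_toReal_le [Finite J] {N : Network I J} {U : ℝ → EReal}
    (hU : IsUtility U) {n x : I → ℝ} (hn : ∀ i, 0 ≤ n i) (hx : N.IsRateAllocation U n x)
    {z : I → ℝ} (hz : N.Feasible n z) (hbot : ∀ i, n i ≠ 0 → U (z i) ≠ ⊥) :
    ∑ i, n i * (U (z i)).toReal ≤ ∑ i, n i * (U (x i)).toReal := by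
  have hle := hx.2.1 hz
  simp only [Set.mem_ofPred_eq] at hle
  rwa [sum_mul_utility_eq_coe hU hz.nonneg hbot,
    sum_mul_utility_eq_coe hU hx.1.nonneg fun i hi => hx.utility_ne_bot hU hn hi,
    EReal.coe_le_coe_iff] at hle

/-- Changing by `d` the rates received from a single resource `j`. -/
theorem feasible_add {N : Network I J} {n x : I → ℝ} {y : I → J → ℝ}
    (hcap : ∀ j, ∑ i with j ∈ N.res i, n i * y i j ≤ N.cap j)
    (hsum : ∀ i, ∑ j ∈ N.res i, y i j = x i) (hy : ∀ i, ∀ j ∈ N.res i, 0 ≤ y i j)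
    {j : J} {d : I → ℝ} (hd : ∀ i, j ∉ N.res i → d i = 0) (hyd : ∀ i, j ∈ N.res i → 0 ≤ y i j + d i)
    (hload : ∑ i with j ∈ N.res i, n i * y i j + ∑ i, n i * d i ≤ N.cap j) :
    N.Feasible n (fun i => x i + d i) := by
  refine ⟨fun i j' => y i j' + if j' = j then d i else 0, fun j' => ?_, fun i => ?_,
    fun i j' hj' => ?_⟩
  · by_cases h : j' = j
    · subst h
      have hsupp : ∑ i with j' ∈ N.res i, n i * d i = ∑ i, n i * d i := by
        refine Finset.sum_filter_of_ne fun i _ hne => ?_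
        by_contra hni
        exact hne (by rw [hd i hni, mul_zero])
      simpa [mul_add, Finset.sum_add_distrib, hsupp] using hload
    · simpa [h] using hcap j'
  · rw [Finset.sum_add_distrib, hsum, Finset.sum_ite_eq']
    by_cases h : j ∈ N.res i
    · simp [h]
    · simp [h, hd i h]
  · by_cases h : j' = j
    · subst h
      simpa using hyd i hj'
    · simpa [h] using hy i j' hj'

variable [Finite J] {N : Network I J} {U : ℝ → EReal} {n x : I → ℝ} {y : I → J → ℝ}

/-- Otherwise all spare capacity of `j` could go to type `i`, strictly raising the total utility. -/
theorem IsRateAllocation.load_eq_cap (hU : IsUtility U) (hn : ∀ i, 0 ≤ n i)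
    (hx : N.IsRateAllocation U n x)
    (hcap : ∀ j, ∑ i with j ∈ N.res i, n i * y i j ≤ N.cap j)
    (hsum : ∀ i, ∑ j ∈ N.res i, y i j = x i) (hy : ∀ i, ∀ j ∈ N.res i, 0 ≤ y i j)
    {i : I} {j : J} (hi : 0 < n i) (hj : j ∈ N.res i) :
    ∑ k with j ∈ N.res k, n k * y k j = N.cap j := by
  classical
  by_contra hne
  have hlt := (hcap j).lt_of_ne hne
  set e := (N.cap j - ∑ k with j ∈ N.res k, n k * y k j) / n i with he
  have hepos : 0 < e := div_pos (by linarith) hi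
  have hne_e : n i * e = N.cap j - ∑ k with j ∈ N.res k, n k * y k j :=
    mul_div_cancel₀ _ hi.ne'
  have hd0 : ∀ k, 0 ≤ (Pi.single i e : I → ℝ) k := fun k => by
    by_cases h : k = i
    · subst h; simpa using hepos.le
    · simp [h]
  have hfeas : N.Feasible n (fun k => x k + (Pi.single i e : I → ℝ) k) := by
    refine feasible_add (j := j) hcap hsum hy (fun k hk => ?_)
      (fun k hk => add_nonneg (hy k j hk) (hd0 k)) ?_
    · simp [show k ≠ i from fun h => hk (h ▸ hj)]
    · have : ∑ k, n k * (Pi.single i e : I → ℝ) k = n i * e := by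
        simp [Pi.single_apply]
      rw [this, hne_e]; linarith
  have hxi := hx.utility_ne_bot hU hn hi.ne'
  have hlt_i := hU.toReal_lt_toReal (hx.1.nonneg i) (lt_add_of_pos_right (x i) hepos) hxi
  refine (hx.sum_toReal_le hU hn hfeas fun k hk => ?_).not_gt ?_
  · by_cases h : k = i
    · subst h
      simpa using hU.ne_bot (add_pos_of_nonneg_of_pos (hx.1.nonneg k) hepos)
    · simpa [h] using hx.utility_ne_bot hU hn hk
  · refine Finset.sum_lt_sum (fun k _ => ?_) ⟨i, Finset.mem_univ i, ?_⟩
    · by_cases h : k = i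
      · subst h
        simpa using mul_le_mul_of_nonneg_left hlt_i.le hi.le
      · simp [h]
    · simpa using mul_lt_mul_of_pos_left hlt_i hi

/-- If `x i < x k`, moving a little of the load of `j` from `k` to `i` would raise the total
utility. -/
theorem IsRateAllocation.le_of_shared_resource (hU : IsUtility U) (hn : ∀ i, 0 ≤ n i)
    (hx : N.IsRateAllocation U n x)
    (hcap : ∀ j, ∑ i with j ∈ N.res i, n i * y i j ≤ N.cap j)
    (hsum : ∀ i, ∑ j ∈ N.res i, y i j = x i) (hy : ∀ i, ∀ j ∈ N.res i, 0 ≤ y i j)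
    {i k : I} {j : J} (hi : 0 < n i) (hk : 0 < n k) (hji : j ∈ N.res i) (hjk : j ∈ N.res k)
    (hykj : 0 < y k j) : x k ≤ x i := by
  classical
  by_contra! hlt
  have hik : k ≠ i := fun h => by simp [h] at hlt
  obtain ⟨a, b, ha, hb, hab, hsep, hby⟩ : ∃ a b : ℝ, 0 < a ∧ 0 < b ∧ n i * a = n k * b ∧
      x i + a ≤ x k - b ∧ b ≤ y k j := by
    -- `e` is the load moved, so the rates change by `e / n i` and `e / n k`. The first bound keeps
    -- `y k j` nonnegative, the second keeps the rates from crossing.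
    set e := min (y k j * n k) ((x k - x i) / (1 / n i + 1 / n k)) with he
    have hden : 0 < 1 / n i + 1 / n k := by positivity
    have hepos : 0 < e := lt_min (mul_pos hykj hk) (div_pos (by linarith) hden)
    refine ⟨e / n i, e / n k, div_pos hepos hi, div_pos hepos hk, ?_, ?_, ?_⟩
    · rw [mul_div_cancel₀ _ hi.ne', mul_div_cancel₀ _ hk.ne']
    · have h := (le_div_iff₀ hden).1 (min_le_right (y k j * n k) _ : e ≤ _)
      have h2 : e * (1 / n i + 1 / n k) = e / n i + e / n k := by ring
      linarith
    · exact (div_le_iff₀ hk).2 (min_le_left _ _)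
  have hxi0 := hx.1.nonneg i
  have hxi := hx.utility_ne_bot hU hn hi.ne'
  set d : I → ℝ := Pi.single i a - Pi.single k b with hd
  have hdi : d i = a := by simp [hd, hik.symm]
  have hdk : d k = -b := by simp [hd, hik]
  have hdo : ∀ l, l ≠ i → l ≠ k → d l = 0 := fun l h1 h2 => by simp [hd, h1, h2]
  have hfeas : N.Feasible n (fun l => x l + d l) := by
    refine feasible_add (j := j) hcap hsum hy (fun l hl => ?_) (fun l hl => ?_) ?_
    · exact hdo l (fun h => hl (h ▸ hji)) (fun h => hl (h ▸ hjk))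
    · by_cases h1 : l = i
      · subst h1; rw [hdi]; exact add_nonneg (hy _ _ hl) ha.le
      by_cases h2 : l = k
      · subst h2; rw [hdk]; linarith
      · rw [hdo l h1 h2, add_zero]; exact hy _ _ hl
    · have : ∑ l, n l * d l = 0 := by
        simp [hd, mul_sub, Finset.sum_sub_distrib, Pi.single_apply, hab]
      rw [this, add_zero]; exact hcap j
  have hle := hx.sum_toReal_le hU hn hfeas fun l hl => by
    by_cases h1 : l = i
    · subst h1; rw [hdi]; exact hU.ne_bot (by linarith)
    by_cases h2 : l = k
    · subst h2; rw [hdk]; exact hU.ne_bot (by linarith)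
    · rw [hdo l h1 h2, add_zero]; exact hx.utility_ne_bot hU hn hl
  rw [← sub_nonpos, ← Finset.sum_sub_distrib, Finset.sum_eq_add_of_mem i k (Finset.mem_univ i)
    (Finset.mem_univ k) hik.symm (fun l _ hl => by simp [hdo l hl.1 hl.2]), hdi, hdk] at hle
  -- The interval gained by `i` lies below the one lost by `k`, so the gain per unit of load is
  -- strictly larger, contradicting `hle`.
  have hslope := hU.slope_anti hxi0 hxi (by linarith : x i < x i + a) hsep
    (by linarith : x k - b < x k)
  rw [sub_sub_cancel, add_sub_cancel_left, div_lt_div_iff₀ hb ha] at hslope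
  rw [← sub_eq_add_neg] at hle
  have h1 := mul_lt_mul_of_pos_left hslope hi
  have h2 : n i * (((U (x k)).toReal - (U (x k - b)).toReal) * a) =
      b * (n k * ((U (x k)).toReal - (U (x k - b)).toReal)) := by
    linear_combination ((U (x k)).toReal - (U (x k - b)).toReal) * hab
  have h3 : b * (n i * (U (x i + a)).toReal - n i * (U (x i)).toReal +
      (n k * (U (x k - b)).toReal - n k * (U (x k)).toReal)) ≤ 0 :=
    mul_nonpos_of_nonneg_of_nonpos hb.le hle
  linarith

end Network

theorem theorem3 {I J : Type*} [Fintype I] [DecidableEq I] [Fintype J] [DecidableEq J]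
    (N : Network I J) (U : ℝ → EReal) (hU : IsUtility U)
    (n : I → ℝ) (hn : ∀ i, 0 ≤ n i)
    (x : I → ℝ) (hx : N.IsRateAllocation U n x)
    (i : I) (hi : 0 < n i) :
    (N.setsContaining i).inf' (N.setsContaining_nonempty i)
      (fun J' => N.capOf J' / ∑ i' ∈ N.flowsIn J', n i') ≤ x i := by
  obtain ⟨y, hcap, hsum, hy⟩ := hx.1
  let F : Finset I := {k | 0 < n k ∧ x k ≤ x i}
  let J' : Finset J := F.biUnion N.res
  have hiF : i ∈ F := by simp [F, hi]
  have hsub : F ⊆ N.flowsIn J' := fun k hk => by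
    simpa [Network.flowsIn, J'] using Finset.subset_biUnion_of_mem N.res hk
  have hmem : J' ∈ N.setsContaining i := by
    simpa [Network.setsContaining] using hsub hiF
  refine (Finset.inf'_le _ hmem).trans ?_
  have hmass : ∑ k ∈ F, n k ≤ ∑ k ∈ N.flowsIn J', n k :=
    Finset.sum_le_sum_of_subset_of_nonneg hsub fun k _ _ => hn k
  have hpos : 0 < ∑ k ∈ N.flowsIn J', n k :=
    Finset.sum_pos' (fun k _ => hn k) ⟨i, hsub hiF, hi⟩
  rw [div_le_iff₀ hpos]
  have hload : ∀ j ∈ J', N.cap j = ∑ k ∈ F, if j ∈ N.res k then n k * y k j else 0 := by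
    intro j hj
    obtain ⟨l, hl, hjl⟩ := Finset.mem_biUnion.1 hj
    obtain ⟨hnl, hxl⟩ : 0 < n l ∧ x l ≤ x i := by simpa [F] using hl
    rw [← hx.load_eq_cap hU hn hcap hsum hy hnl hjl, Finset.sum_filter]
    refine (Finset.sum_subset (Finset.subset_univ F) fun k _ hkF => ?_).symm
    split_ifs with hjk
    · by_contra hne
      have hnk : 0 < n k := (hn k).lt_of_ne' (left_ne_zero_of_mul hne)
      have hyk : 0 < y k j := (hy k j hjk).lt_of_ne' (right_ne_zero_of_mul hne)
      have hle := hx.le_of_shared_resource hU hn hcap hsum hy hnl hnk hjl hjk hyk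
      exact hkF (by simpa [F] using ⟨hnk, hle.trans hxl⟩)
    · rfl
  calc N.capOf J' = ∑ k ∈ F, n k * x k := by
        -- Double counting: `J'` contains all of `res k` for `k ∈ F`, so the inner sums recover the
        -- full rates `x k`.
        rw [Network.capOf, Finset.sum_congr rfl hload, Finset.sum_comm]
        refine Finset.sum_congr rfl fun k hk => ?_
        rw [← hsum k, Finset.mul_sum, ← Finset.sum_filter, Finset.filter_mem_eq_inter,
          Finset.inter_eq_right.2 (Finset.subset_biUnion_of_mem N.res hk)]
    _ ≤ ∑ k ∈ F, n k * x i := Finset.sum_le_sum fun k hk =>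
        mul_le_mul_of_nonneg_left (by simpa [F] using (Finset.mem_filter.1 hk).2.2) (hn k)
    _ = x i * ∑ k ∈ F, n k := by rw [← Finset.sum_mul, mul_comm]
    _ ≤ x i * ∑ k ∈ N.flowsIn J', n k := mul_le_mul_of_nonneg_left hmass (hx.1.nonneg i)
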